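/- All graphs are finite, simple and undirected. A graph is chordal bipartite if it is bipartite and has no induced cycle of length at least $6$. The bipartite claw $T_2$ is the $7$-vertex tree obtained from the star $K_{1,3}$ by attaching one pendant vertex to each of its three leaves; a graph is $T_2$-free if it has no induced subgraph isomorphic to $T_2$. A coherent configuration on a finite set $\Omega$ is a pair $\mathcal X=(\Omega,S)$, where $S$ is a partition of $\Omega\times\Omega$ such that: (C1) the diagonal $\{(\omega,\omega):\omega\in\Omega\}$ is a union of elements of $S$; (C2) $s\in S$ implies $s^*=\{(\alpha,\beta):(\beta,\alpha)\in s\}\in S$; (C3) for all $r,s,t\in S$ the number $|\{\gamma:(\alpha,\gamma)\in r,\ (\gamma,\beta)\in s\}|$ does not depend on $(\alpha,\beta)\in t$. The elements of $S$ are called basis relations. A set $\Delta\subseteq\Omega$ is a fiber of $\mathcal X$ if $\{(\delta,\delta):\delta\in\Delta\}\in S$; the set of fibers is denoted by $F(\mathcal X)$. One writes $\mathcal X\le\mathcal X'$ if every basis relation of $\mathcal X$ is a union of basis relations of $\mathcal X'$. For a graph $X$ with vertex set $\Omega$, arc set $D=\{(\beta,\gamma): \beta,\gamma \text{ adjacent}\}$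 and distinguished vertex $\alpha$, $\mathrm{WL}(X)$ denotes the smallest coherent configuration on $\Omega$ for which both $D$ and $\{(\alpha,\alpha)\}$ are unions of basis relations. Two vertices of a graph are twins if every other vertex is adjacent to both of them or to neither. For $\Delta,\Gamma\in F(\mathcal X)$ let $X_{\Delta,\Gamma}$ be the graph with vertex set $\Delta\cup\Gamma$ and arc set $D\cap\bigl((\Delta\times\Gamma)\cup(\Gamma\times\Delta)\bigr)$, and let $e_{\Delta,\Gamma}$ be the equivalence relation on $\Delta$ consisting of all pairs of elements of $\Delta$ that are twins of $X_{\Delta,\Gamma}$. Denote by $\|e_{\Delta,\Gamma}\|$ the number of its classes. **Theorem.** Let $X$ be a connected chordal bipartite $T_2$-free graph with a distinguished vertex $\alpha$, and let $\mathcal X\ge\mathrm{WL}(X)$ be a coherent configuration on the vertex set of $X$. Then for all $\Delta,\Gamma\in F(\mathcal X)$, $$\|e_{\Delta,\Gamma}\|\le 2.$$ -/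

import Mathlib

/-- A coherent configuration on a (finite) set `Ω`: a partition `basis` of `Ω × Ω` into
nonempty sets, the basis relations, satisfying the three axioms (C1), (C2), (C3). -/
structure CoherentConfiguration (Ω : Type*) [Finite Ω] where
  /-- the set of basis relations -/
  basis : Set (Set (Ω × Ω))
  isPartition : Setoid.IsPartition basis
  /-- (C1): the diagonal is a union of basis relations -/
  diagonal_eq : ∃ T ⊆ basis, Set.diagonal Ω = ⋃₀ T
  /-- (C2): the transpose of a basis relation is a basis relation -/
  transpose_mem : ∀ s ∈ basis, {p : Ω × Ω | (p.2, p.1) ∈ s} ∈ basis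
  /-- (C3): existence of the intersection numbers -/
  intersection_number : ∀ r ∈ basis, ∀ s ∈ basis, ∀ t ∈ basis, ∃ c : ℕ,
    ∀ α β : Ω, (α, β) ∈ t → {γ : Ω | (α, γ) ∈ r ∧ (γ, β) ∈ s}.ncard = c

namespace CoherentConfiguration

variable {Ω : Type*} [Finite Ω]

/-- `R` is a union of basis relations of `𝒳`. -/
def IsRelation (𝒳 : CoherentConfiguration Ω) (R : Set (Ω × Ω)) : Prop :=
  ∃ T ⊆ 𝒳.basis, R = ⋃₀ T

/-- `Δ` is a fiber of `𝒳`: the diagonal of `Δ` is a basis relation. -/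
def IsFiber (𝒳 : CoherentConfiguration Ω) (Δ : Set Ω) : Prop :=
  {p : Ω × Ω | p.1 ∈ Δ ∧ p.1 = p.2} ∈ 𝒳.basis

/-- `𝒳 ≤ 𝒴` if every basis relation of `𝒳` is a union of basis relations of `𝒴`. -/
instance : LE (CoherentConfiguration Ω) :=
  ⟨fun 𝒳 𝒴 => ∀ s ∈ 𝒳.basis, 𝒴.IsRelation s⟩

/-- The equivalence relation on `Ω × Ω` whose classes are the basis relations. -/
def setoid (𝒳 : CoherentConfiguration Ω) : Setoid (Ω × Ω) :=
  Setoid.mkClasses 𝒳.basis 𝒳.isPartition.2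

theorem classes_setoid (𝒳 : CoherentConfiguration Ω) : 𝒳.setoid.classes = 𝒳.basis :=
  Setoid.classes_mkClasses 𝒳.basis 𝒳.isPartition

theorem setoid_class_mem (𝒳 : CoherentConfiguration Ω) (q : Ω × Ω) :
    {p | 𝒳.setoid p q} ∈ 𝒳.basis := by
  rw [← 𝒳.classes_setoid]
  exact Setoid.mem_classes _ q

theorem mem_iff_of_setoid (𝒳 : CoherentConfiguration Ω) {s : Set (Ω × Ω)} (hs : s ∈ 𝒳.basis)
    {p q : Ω × Ω} (h : 𝒳.setoid p q) : p ∈ s ↔ q ∈ s := by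
  rw [← 𝒳.classes_setoid] at hs
  obtain ⟨y, rfl⟩ := hs
  exact ⟨fun hp => 𝒳.setoid.trans (𝒳.setoid.symm h) hp, fun hq => 𝒳.setoid.trans h hq⟩

theorem isRelation_iff (𝒳 : CoherentConfiguration Ω) (R : Set (Ω × Ω)) :
    𝒳.IsRelation R ↔ ∀ p q, 𝒳.setoid p q → (p ∈ R ↔ q ∈ R) := by
  constructor
  · rintro ⟨T, hT, rfl⟩ p q h
    simp only [Set.mem_sUnion]
    exact exists_congr fun s => and_congr_right fun hs => 𝒳.mem_iff_of_setoid (hT hs) h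
  · intro h
    refine ⟨{s ∈ 𝒳.basis | s ⊆ R}, fun s hs => hs.1, ?_⟩
    ext q
    simp only [Set.mem_sUnion]
    constructor
    · intro hq
      exact ⟨_, ⟨𝒳.setoid_class_mem q, fun p hp => (h p q hp).2 hq⟩, 𝒳.setoid.refl q⟩
    · rintro ⟨s, hs, hqs⟩
      exact hs.2 hqs

theorem le_iff_setoid_le (𝒳 𝒴 : CoherentConfiguration Ω) : 𝒳 ≤ 𝒴 ↔ 𝒴.setoid ≤ 𝒳.setoid := by
  constructor
  · intro h p q hpq
    exact (((𝒴.isRelation_iff _).1 (h _ (𝒳.setoid_class_mem q))) p q hpq).2 (𝒳.setoid.refl q)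
  · intro h s hs
    exact (𝒴.isRelation_iff s).2 fun p q hpq => 𝒳.mem_iff_of_setoid hs (h hpq)

instance : PartialOrder (CoherentConfiguration Ω) where
  le_refl 𝒳 := (le_iff_setoid_le 𝒳 𝒳).2 le_rfl
  le_trans 𝒳 𝒴 𝒵 h h' := (le_iff_setoid_le 𝒳 𝒵).2
    (le_trans ((le_iff_setoid_le 𝒴 𝒵).1 h') ((le_iff_setoid_le 𝒳 𝒴).1 h))
  le_antisymm 𝒳 𝒴 h h' := by
    have e : 𝒳.setoid = 𝒴.setoid :=
      le_antisymm ((le_iff_setoid_le 𝒴 𝒳).1 h') ((le_iff_setoid_le 𝒳 𝒴).1 h)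
    have e' : 𝒳.basis = 𝒴.basis := by rw [← 𝒳.classes_setoid, ← 𝒴.classes_setoid, e]
    cases 𝒳
    cases 𝒴
    cases e'
    rfl

theorem setoid_swap (𝒳 : CoherentConfiguration Ω) {p q : Ω × Ω} (h : 𝒳.setoid p q) :
    𝒳.setoid (p.2, p.1) (q.2, q.1) :=
  (𝒳.mem_iff_of_setoid (𝒳.transpose_mem _ (𝒳.setoid_class_mem (q.2, q.1))) h).2
    (𝒳.setoid.refl _)

theorem ncard_eq_of_setoid (𝒳 : CoherentConfiguration Ω) {r s : Set (Ω × Ω)}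
    (hr : 𝒳.IsRelation r) (hs : 𝒳.IsRelation s) {p q : Ω × Ω} (h : 𝒳.setoid p q) :
    {γ : Ω | (p.1, γ) ∈ r ∧ (γ, p.2) ∈ s}.ncard =
      {γ : Ω | (q.1, γ) ∈ r ∧ (γ, q.2) ∈ s}.ncard := by
  classical
  have := Fintype.ofFinite Ω
  rw [isRelation_iff] at hr hs
  let col : Ω × Ω → Ω → Quotient 𝒳.setoid × Quotient 𝒳.setoid :=
    fun x γ => (Quotient.mk _ (x.1, γ), Quotient.mk _ (γ, x.2))
  let A : Finset (Quotient 𝒳.setoid × Quotient 𝒳.setoid) :=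
    Finset.univ.filter fun c => (∃ x ∈ r, Quotient.mk _ x = c.1) ∧ ∃ x ∈ s, Quotient.mk _ x = c.2
  have mem_A : ∀ x γ, col x γ ∈ A ↔ (x.1, γ) ∈ r ∧ (γ, x.2) ∈ s := by
    intro x γ
    simp only [A, col, Finset.mem_filter, Finset.mem_univ, true_and]
    refine and_congr ⟨?_, fun hx => ⟨_, hx, rfl⟩⟩ ⟨?_, fun hx => ⟨_, hx, rfl⟩⟩
    · rintro ⟨y, hy, e⟩
      exact (hr _ _ (Quotient.exact e)).1 hy
    · rintro ⟨y, hy, e⟩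
      exact (hs _ _ (Quotient.exact e)).1 hy
  have key : ∀ x : Ω × Ω, {γ : Ω | (x.1, γ) ∈ r ∧ (γ, x.2) ∈ s}.ncard =
      ∑ c ∈ A, {γ : Ω | col x γ = c}.ncard := by
    intro x
    have e1 : {γ : Ω | (x.1, γ) ∈ r ∧ (γ, x.2) ∈ s} =
        ((Finset.univ.filter fun γ => col x γ ∈ A : Finset Ω) : Set Ω) := by
      ext γ
      simp [mem_A]
    rw [e1, Set.ncard_coe_finset, Finset.card_eq_sum_card_fiberwise (f := col x) (t := A)
      (by intro γ hγ; simpa using hγ)]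
    refine Finset.sum_congr rfl fun c hc => ?_
    rw [← Set.ncard_coe_finset]
    congr 1
    ext γ
    simp only [Finset.coe_filter, Finset.mem_filter, Finset.mem_univ, true_and, Set.mem_ofPred_eq]
    exact ⟨fun h => h.2, fun h => ⟨h ▸ hc, h⟩⟩
  rw [key, key]
  refine Finset.sum_congr rfl ?_
  rintro ⟨c, d⟩ -
  induction c using Quotient.inductionOn with | _ c => ?_
  induction d using Quotient.inductionOn with | _ d => ?_
  obtain ⟨n, hn⟩ := 𝒳.intersection_number _ (𝒳.setoid_class_mem c) _ (𝒳.setoid_class_mem d) _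
    (𝒳.setoid_class_mem q)
  have e : ∀ x : Ω × Ω, {γ : Ω | col x γ = (Quotient.mk _ c, Quotient.mk _ d)} =
      {γ : Ω | (x.1, γ) ∈ {y | 𝒳.setoid y c} ∧ (γ, x.2) ∈ {y | 𝒳.setoid y d}} := by
    intro x
    ext γ
    simp only [col, Set.mem_ofPred_eq, Prod.mk.injEq]
    exact and_congr Quotient.eq Quotient.eq
  rw [e, e, hn p.1 p.2 h, hn q.1 q.2 (𝒳.setoid.refl q)]

/-- The equivalence relation on `Ω × Ω` generated by all the partitions into basis relations of
coherent configurations for which each member of `T` is a union of basis relations. -/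
def closureSetoid (T : Set (Set (Ω × Ω))) : Setoid (Ω × Ω) :=
  sSup {e | ∃ 𝒴 : CoherentConfiguration Ω, (∀ R ∈ T, 𝒴.IsRelation R) ∧ 𝒴.setoid = e}

theorem setoid_le_closureSetoid {T : Set (Set (Ω × Ω))} {𝒴 : CoherentConfiguration Ω}
    (h : ∀ R ∈ T, 𝒴.IsRelation R) : 𝒴.setoid ≤ closureSetoid T :=
  le_sSup ⟨𝒴, h, rfl⟩

theorem closureSetoid_le_ker {T : Set (Set (Ω × Ω))} {β : Type*} (f : Ω × Ω → β)
    (h : ∀ 𝒴 : CoherentConfiguration Ω, (∀ R ∈ T, 𝒴.IsRelation R) →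
      ∀ p q, 𝒴.setoid p q → f p = f q) {p q : Ω × Ω} (hpq : closureSetoid T p q) : f p = f q := by
  have : closureSetoid T ≤ Setoid.ker f := by
    refine sSup_le ?_
    rintro e ⟨𝒴, hY, rfl⟩ p q hpq
    exact h 𝒴 hY p q hpq
  exact this hpq

theorem isRelation_of_mem_classes {T : Set (Set (Ω × Ω))} {𝒴 : CoherentConfiguration Ω}
    (h : ∀ R ∈ T, 𝒴.IsRelation R) {s : Set (Ω × Ω)} (hs : s ∈ (closureSetoid T).classes) :
    𝒴.IsRelation s := by
  rw [isRelation_iff]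
  obtain ⟨y, rfl⟩ := hs
  intro p q hpq
  have hpq' := setoid_le_closureSetoid h hpq
  exact ⟨fun hp => (closureSetoid T).trans ((closureSetoid T).symm hpq') hp,
    fun hq => (closureSetoid T).trans hpq' hq⟩

/-- The coherent closure `WL(T)` of a set `T` of binary relations on `Ω`; by
`isLeast_coherentClosure` it is the smallest coherent configuration for which each relation
in `T` is a union of basis relations. -/
def coherentClosure (T : Set (Set (Ω × Ω))) : CoherentConfiguration Ω where
  basis := (closureSetoid T).classes
  isPartition := Setoid.isPartition_classes _
  diagonal_eq := by
    refine ⟨{s ∈ (closureSetoid T).classes | s ⊆ Set.diagonal Ω}, fun s hs => hs.1, ?_⟩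
    ext q
    simp only [Set.mem_sUnion]
    constructor
    · intro hq
      refine ⟨_, ⟨Setoid.mem_classes _ q, fun p hp => ?_⟩, (closureSetoid T).refl q⟩
      have := closureSetoid_le_ker (fun x : Ω × Ω => x ∈ Set.diagonal Ω)
        (fun 𝒴 _ a b hab => propext ((𝒴.isRelation_iff _).1 𝒴.diagonal_eq a b hab)) hp
      exact this.mpr hq
    · rintro ⟨s, hs, hqs⟩
      exact hs.2 hqs
  transpose_mem := by
    have key : ∀ p q : Ω × Ω, closureSetoid T p q →
        closureSetoid T (p.2, p.1) (q.2, q.1) := by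
      intro p q hpq
      exact Quotient.exact (closureSetoid_le_ker
        (fun x : Ω × Ω => (Quotient.mk (closureSetoid T) (x.2, x.1)))
        (fun 𝒴 hY a b hab => Quotient.sound
          (setoid_le_closureSetoid hY (𝒴.setoid_swap hab))) hpq)
    rintro s ⟨y, rfl⟩
    refine ⟨(y.2, y.1), ?_⟩
    ext p
    exact ⟨fun h => key _ _ h, fun h => key _ _ h⟩
  intersection_number := by
    rintro r hr s hs t ⟨y, rfl⟩
    refine ⟨{γ : Ω | (y.1, γ) ∈ r ∧ (γ, y.2) ∈ s}.ncard, fun α β h => ?_⟩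
    exact closureSetoid_le_ker
      (fun x : Ω × Ω => {γ : Ω | (x.1, γ) ∈ r ∧ (γ, x.2) ∈ s}.ncard)
      (fun 𝒴 hY a b hab => 𝒴.ncard_eq_of_setoid (isRelation_of_mem_classes hY hr)
        (isRelation_of_mem_classes hY hs) hab) h

theorem isLeast_coherentClosure (T : Set (Set (Ω × Ω))) :
    IsLeast {𝒴 : CoherentConfiguration Ω | ∀ R ∈ T, 𝒴.IsRelation R} (coherentClosure T) := by
  constructor
  · intro R hR
    rw [isRelation_iff]
    intro p q hpq
    have hpq' : closureSetoid T p q := by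
      have := (coherentClosure T).mem_iff_of_setoid (Setoid.mem_classes (closureSetoid T) q) hpq
      exact this.2 ((closureSetoid T).refl q)
    exact iff_of_eq (closureSetoid_le_ker (fun x : Ω × Ω => x ∈ R)
      (fun 𝒴 hY a b hab => propext ((𝒴.isRelation_iff _).1 (hY R hR) a b hab)) hpq')
  · intro 𝒴 hY s hs
    exact isRelation_of_mem_classes hY hs

end CoherentConfiguration

namespace SimpleGraph

variable {Ω : Type*}

/-- The arc set of a graph. -/
def arcSet (X : SimpleGraph Ω) : Set (Ω × Ω) := {p | X.Adj p.1 p.2}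

/-- The coherent configuration `WL(X_α)` of the graph `X` with distinguished vertex `α`: the
coherent closure of the arc set of `X` together with `{(α, α)}`. -/
def WL [Finite Ω] (X : SimpleGraph Ω) (α : Ω) : CoherentConfiguration Ω :=
  CoherentConfiguration.coherentClosure {X.arcSet, {(α, α)}}

/-- A chordal bipartite graph: a bipartite graph without induced cycles of length at least 6. -/
def IsChordalBipartite (X : SimpleGraph Ω) : Prop :=
  X.IsBipartite ∧ ∀ n : ℕ, 6 ≤ n → ¬ (cycleGraph n).IsIndContained X

/-- The bipartite claw `T₂`: the claw with center `0` and leaves `1, 2, 3`, with pendant vertices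
`4, 5, 6` attached to the three leaves. -/
def bipartiteClaw : SimpleGraph (Fin 7) :=
  fromEdgeSet {s(0, 1), s(0, 2), s(0, 3), s(1, 4), s(2, 5), s(3, 6)}

/-- The equivalence relation "to be twins" on the vertices of a graph: `a` and `b` are twins if
every other vertex is adjacent to both of them or to none of them. -/
def twinSetoid (X : SimpleGraph Ω) : Setoid Ω where
  r a b := ∀ c, c ≠ a → c ≠ b → (X.Adj c a ↔ X.Adj c b)
  iseqv :=
    { refl := fun _ _ _ _ => Iff.rfl
      symm := fun h c hb ha => (h c ha hb).symm
      trans := by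
        intro a b c hab hbc d hda hdc
        by_cases hdb : d = b
        · subst hdb
          by_cases hac : a = c
          · subst hac
            exact Iff.rfl
          · have h1 := hab c (Ne.symm hac) hdc.symm
            have h2 := hbc a hda.symm hac
            rw [X.adj_comm d a, X.adj_comm d c, h2, X.adj_comm a c, h1]
        · exact (hab d hda hdb).trans (hbc d hdb hdc) }

/-- The graph `X_{Δ,Γ}` with vertex set `Δ ∪ Γ` and arc set `D_{Δ,Γ} ∪ D_{Γ,Δ}`, where `D` is
the arc set of `X`. -/
def graphBetween (X : SimpleGraph Ω) (Δ Γ : Set Ω) : SimpleGraph ↥(Δ ∪ Γ) where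
  Adj u v := X.Adj u v ∧ ((u.1 ∈ Δ ∧ v.1 ∈ Γ) ∨ (u.1 ∈ Γ ∧ v.1 ∈ Δ))
  symm := ⟨fun _ _ h => ⟨h.1.symm, h.2.symm.imp And.symm And.symm⟩⟩
  loopless := ⟨fun _ h => X.irrefl h.1⟩

/-- The equivalence relation `e_{Δ,Γ}` on `Δ`: to be twins in the graph `X_{Δ,Γ}`. -/
def twinsBetween (X : SimpleGraph Ω) (Δ Γ : Set Ω) : Setoid ↥Δ :=
  (X.graphBetween Δ Γ).twinSetoid.comap (Set.inclusion Set.subset_union_left)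

end SimpleGraph

/-! The points of one fiber have equally many neighbors in any given fiber and are equidistant from
`α`. Suppose a path `a b c d` alternates between two fibers while `a` and `d` are nonadjacent. Equal
degrees then extend it to an infinite walk with no two vertices three steps apart adjacent, and in a
finite bipartite graph such a walk contains a long induced cycle. So the graph between two fibers is
a disjoint union of complete bipartite graphs (`adj_of_path`), and three twin classes would give an
induced matching with three edges.

`not_induced_matching` excludes this by descending toward `α`. Take neighbors of the inner ends one
step closer to `α`, all in one fiber. If they again form an induced matching, recurse. Otherwise one
of them sees two inner ends, which supply two legs of a bipartite claw; the third leg is the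
remaining matching edge or a path toward `α`. -/

namespace CoherentConfiguration

/-! ### Fibers and counting of neighbors -/

variable {Ω : Type*} [Finite Ω] {𝒳 : CoherentConfiguration Ω}

/-- Two points are equivalent if they lie in the same fiber. -/
def fiberSetoid (𝒳 : CoherentConfiguration Ω) : Setoid Ω :=
  𝒳.setoid.comap fun x => (x, x)

theorem isRelation_univ (𝒳 : CoherentConfiguration Ω) : 𝒳.IsRelation Set.univ :=
  (𝒳.isRelation_iff _).2 fun _ _ _ => by simp

theorem isRelation_class (𝒳 : CoherentConfiguration Ω) (q : Ω × Ω) :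
    𝒳.IsRelation {p | 𝒳.setoid p q} :=
  ⟨{{p | 𝒳.setoid p q}}, by simpa using 𝒳.setoid_class_mem q, by simp⟩

/-- Count the `γ` for which `(γ, b)` has the color of `(b, b)`: there is at least one, namely `b`.
The same number at `(c, d)` yields a `γ`, and the diagonal being a relation forces `γ = d`. -/
theorem fiberSetoid_snd {a b c d : Ω} (h : 𝒳.setoid (a, b) (c, d)) : 𝒳.fiberSetoid b d := by
  have hcount := 𝒳.ncard_eq_of_setoid 𝒳.isRelation_univ (𝒳.isRelation_class (b, b)) h
  have hpos : 0 < {γ : Ω | ((a, b).1, γ) ∈ Set.univ ∧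
      (γ, (a, b).2) ∈ {p | 𝒳.setoid p (b, b)}}.ncard :=
    (Set.ncard_pos (Set.toFinite _)).2 ⟨b, trivial, 𝒳.setoid.refl _⟩
  rw [hcount, Set.ncard_pos (Set.toFinite _)] at hpos
  obtain ⟨γ, -, hγ⟩ := hpos
  have hdiag := ((𝒳.isRelation_iff _).1 𝒳.diagonal_eq _ _ hγ).2 rfl
  have hγd : γ = d := hdiag
  subst hγd
  exact 𝒳.setoid.symm hγ

theorem ncard_neighbors_eq {R : Set (Ω × Ω)} (hR : 𝒳.IsRelation R) {x y : Ω}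
    (h : 𝒳.fiberSetoid x y) : {γ | (x, γ) ∈ R}.ncard = {γ | (y, γ) ∈ R}.ncard := by
  simpa using 𝒳.ncard_eq_of_setoid hR 𝒳.isRelation_univ h

theorem isRelation_inter_fiber {R : Set (Ω × Ω)} (hR : 𝒳.IsRelation R) (a : Ω) :
    𝒳.IsRelation {p | p ∈ R ∧ 𝒳.fiberSetoid p.2 a} := by
  rw [isRelation_iff] at hR ⊢
  rintro ⟨p, p'⟩ ⟨q, q'⟩ h
  have h' := fiberSetoid_snd h
  exact and_congr (hR _ _ h)
    ⟨fun k => 𝒳.fiberSetoid.trans (𝒳.fiberSetoid.symm h') k, fun k => 𝒳.fiberSetoid.trans h' k⟩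

theorem exists_of_fiberSetoid {R : Set (Ω × Ω)} (hR : 𝒳.IsRelation R) {x y x' : Ω}
    (h : 𝒳.fiberSetoid x y) (hx : (x, x') ∈ R) : ∃ y', (y, y') ∈ R ∧ 𝒳.fiberSetoid y' x' := by
  have hcount := ncard_neighbors_eq (isRelation_inter_fiber hR x') h
  have hpos : 0 < {γ | (x, γ) ∈ {p | p ∈ R ∧ 𝒳.fiberSetoid p.2 x'}}.ncard :=
    (Set.ncard_pos (Set.toFinite _)).2 ⟨x', hx, 𝒳.fiberSetoid.refl _⟩
  rw [hcount, Set.ncard_pos (Set.toFinite _)] at hpos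
  exact hpos

/-- Points of a fiber have equally many neighbors in each fiber. -/
theorem exists_mem_not_mem {R : Set (Ω × Ω)} (hR : 𝒳.IsRelation R) {x y a : Ω}
    (h : 𝒳.fiberSetoid x y) (hx : (x, a) ∈ R) (hy : (y, a) ∉ R) :
    ∃ b, (y, b) ∈ R ∧ (x, b) ∉ R ∧ 𝒳.fiberSetoid b a := by
  by_contra! hcon
  have hcount := ncard_neighbors_eq (isRelation_inter_fiber hR a) h
  -- Inclusion together with equal cardinality would make the two neighborhoods in the fiber of `a`
  -- coincide, yet only `x` sees `a`.
  have hsub : {γ | (y, γ) ∈ {p | p ∈ R ∧ 𝒳.fiberSetoid p.2 a}} ⊆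
      {γ | (x, γ) ∈ {p | p ∈ R ∧ 𝒳.fiberSetoid p.2 a}} := by
    rintro γ ⟨hγ, hγa⟩
    refine ⟨?_, hγa⟩
    by_contra hxγ
    exact hcon γ hγ hxγ hγa
  have heq := Set.eq_of_subset_of_ncard_le hsub hcount.le (Set.toFinite _)
  have ha : a ∈ {γ | (y, γ) ∈ {p | p ∈ R ∧ 𝒳.fiberSetoid p.2 a}} := by
    rw [heq]
    exact ⟨hx, 𝒳.fiberSetoid.refl _⟩
  exact hy ha.1

theorem IsFiber.fiberSetoid {Δ : Set Ω} (hΔ : 𝒳.IsFiber Δ) {x y : Ω} (hx : x ∈ Δ) (hy : y ∈ Δ) :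
    𝒳.fiberSetoid x y := by
  have hx' : (x, x) ∈ {p : Ω × Ω | p.1 ∈ Δ ∧ p.1 = p.2} := ⟨hx, rfl⟩
  have hy' : (y, y) ∈ {p : Ω × Ω | p.1 ∈ Δ ∧ p.1 = p.2} := ⟨hy, rfl⟩
  unfold IsFiber at hΔ
  rw [← 𝒳.classes_setoid] at hΔ
  obtain ⟨z, hz⟩ := hΔ
  rw [hz] at hx' hy'
  exact 𝒳.setoid.trans hx' (𝒳.setoid.symm hy')

theorem IsFiber.mem_of_fiberSetoid {Δ : Set Ω} (hΔ : 𝒳.IsFiber Δ) {x y : Ω}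
    (h : 𝒳.fiberSetoid x y) (hy : y ∈ Δ) : x ∈ Δ :=
  ((𝒳.mem_iff_of_setoid hΔ h).2 ⟨hy, rfl⟩).1

theorem IsRelation.of_le {𝒴 : CoherentConfiguration Ω} {R : Set (Ω × Ω)} (h : 𝒴 ≤ 𝒳)
    (hR : 𝒴.IsRelation R) : 𝒳.IsRelation R := by
  rw [isRelation_iff] at hR ⊢
  exact fun p q hpq => hR p q ((le_iff_setoid_le 𝒴 𝒳).1 h hpq)

end CoherentConfiguration

/-! ### Distances from the distinguished vertex -/

namespace SimpleGraph

open CoherentConfiguration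

variable {Ω : Type*} {X : SimpleGraph Ω}

theorem isRelation_arcSet [Finite Ω] {α : Ω} {𝒳 : CoherentConfiguration Ω} (h : X.WL α ≤ 𝒳) :
    𝒳.IsRelation X.arcSet :=
  IsRelation.of_le h ((isLeast_coherentClosure {X.arcSet, {(α, α)}}).1 _ (by simp))

theorem isRelation_singleton [Finite Ω] {α : Ω} {𝒳 : CoherentConfiguration Ω} (h : X.WL α ≤ 𝒳) :
    𝒳.IsRelation {(α, α)} :=
  IsRelation.of_le h ((isLeast_coherentClosure {X.arcSet, {(α, α)}}).1 _ (by simp))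

theorem Connected.exists_adj_dist_eq (hX : X.Connected) {α x : Ω} {n : ℕ}
    (h : X.dist α x = n + 1) : ∃ y, X.Adj x y ∧ X.dist α y = n := by
  obtain ⟨p, hp⟩ := hX.exists_walk_length_eq_dist x α
  rw [dist_comm] at h
  cases p with
  | nil => simp at h
  | @cons _ y _ hxy q =>
    refine ⟨y, hxy, ?_⟩
    have h1 : X.dist α y ≤ q.length := dist_comm (G := X) (u := y) ▸ dist_le q
    have h2 := hxy.diff_dist_adj (u := α)
    simp only [Walk.length_cons] at hp
    rw [dist_comm (u := α) (v := x)] at h2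
    omega

/-- Induction on `n`: `{α}` is its own fiber, and a neighbor of `x` closer to `α` is matched by a
neighbor of `y` in the same fiber. -/
theorem dist_le_of_fiberSetoid [Finite Ω] (hX : X.Connected) {α : Ω} {𝒳 : CoherentConfiguration Ω}
    (hWL : X.WL α ≤ 𝒳) (n : ℕ) :
    ∀ {x y : Ω}, 𝒳.fiberSetoid x y → X.dist α x = n → X.dist α y ≤ n := by
  induction n with
  | zero =>
    intro x y h hx
    have hxα : α = x := hX.dist_eq_zero_iff.1 hx
    have := ((𝒳.isRelation_iff _).1 (isRelation_singleton hWL) _ _ h).1 (by simp [hxα])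
    have hy : y = α := by simpa using this
    simp [hy]
  | succ n ih =>
    intro x y h hx
    obtain ⟨x', hxx', hx'⟩ := hX.exists_adj_dist_eq hx
    obtain ⟨y', hyy', hy'⟩ := exists_of_fiberSetoid (isRelation_arcSet hWL) h hxx'
    have h1 := ih (𝒳.fiberSetoid.symm hy') hx'
    have h2 : X.Adj y y' := hyy'
    have h3 := h2.diff_dist_adj (u := α)
    omega

theorem dist_eq_of_fiberSetoid [Finite Ω] (hX : X.Connected) {α : Ω} {𝒳 : CoherentConfiguration Ω}
    (hWL : X.WL α ≤ 𝒳) {x y : Ω} (h : 𝒳.fiberSetoid x y) : X.dist α x = X.dist α y :=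
  le_antisymm (dist_le_of_fiberSetoid hX hWL _ (𝒳.fiberSetoid.symm h) rfl)
    (dist_le_of_fiberSetoid hX hWL _ h rfl)

theorem IsBipartite.nonempty_coloring (hX : X.IsBipartite) : Nonempty (X.Coloring Bool) :=
  Nonempty.map (fun c => X.recolorOfEquiv finTwoEquiv c) hX

/-- The parity of the distance to `α` determines the color in a 2-coloring. -/
theorem dist_ne_of_adj (hX : X.Connected) (hb : X.IsBipartite) {α x y : Ω} (h : X.Adj x y) :
    X.dist α x ≠ X.dist α y := by
  obtain ⟨c⟩ := hb.nonempty_coloring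
  intro he
  obtain ⟨p, hp⟩ := hX.exists_walk_length_eq_dist α x
  obtain ⟨q, hq⟩ := hX.exists_walk_length_eq_dist α y
  have h1 := c.even_length_iff_congr p
  have h2 := c.even_length_iff_congr q
  have h3 := c.valid h
  rw [hp, he, ← hq, h2] at h1
  apply h3
  rw [Bool.eq_iff_iff]
  tauto

/-! ### Recognizing a bipartite claw -/

/-- A bipartite graph containing the spider with three legs of length two contains it as an
induced subgraph as soon as no middle vertex of a leg is adjacent to the end of another leg. -/
theorem bipartiteClaw_isIndContained (hb : X.IsBipartite) {c a₁ a₂ a₃ b₁ b₂ b₃ : Ω}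
    (hc₁ : X.Adj c a₁) (hc₂ : X.Adj c a₂) (hc₃ : X.Adj c a₃)
    (h₁ : X.Adj a₁ b₁) (h₂ : X.Adj a₂ b₂) (h₃ : X.Adj a₃ b₃)
    (h₁₂ : ¬ X.Adj a₁ b₂) (h₁₃ : ¬ X.Adj a₁ b₃) (h₂₁ : ¬ X.Adj a₂ b₁) (h₂₃ : ¬ X.Adj a₂ b₃)
    (h₃₁ : ¬ X.Adj a₃ b₁) (h₃₂ : ¬ X.Adj a₃ b₂) : bipartiteClaw.IsIndContained X := by
  obtain ⟨col⟩ := hb.nonempty_coloring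
  have key : ∀ x y : Ω, X.Adj x y → col x = !col y := fun x y h => by
    have := col.valid h
    cases hx : col x <;> cases hy : col y <;> simp_all
  have nadj : ∀ x y : Ω, col x = col y → ¬ X.Adj x y := fun x y h h' => col.valid h' h
  have e₁ := key _ _ hc₁.symm
  have e₂ := key _ _ hc₂.symm
  have e₃ := key _ _ hc₃.symm
  have f₁ : col b₁ = col c := by rw [key _ _ h₁.symm, e₁, Bool.not_not]
  have f₂ : col b₂ = col c := by rw [key _ _ h₂.symm, e₂, Bool.not_not]
  have f₃ : col b₃ = col c := by rw [key _ _ h₃.symm, e₃, Bool.not_not]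
  have inj : Function.Injective ![c, a₁, a₂, a₃, b₁, b₂, b₃] := by
    -- Vertices of different colors are separated by color, those of the same color by a vertex
    -- adjacent to exactly one of them.
    have hne : ∀ x y z : Ω, X.Adj x y → ¬ X.Adj x z → y ≠ z := by
      rintro x y z h h' rfl
      exact h' h
    have hca : ∀ x y : Ω, col x = col c → col y = !col c → x ≠ y := by
      rintro x y hx hy rfl
      rw [hx] at hy
      exact Bool.self_ne_not _ hy
    have := hca c _ rfl e₁
    have := hca c _ rfl e₂
    have := hca c _ rfl e₃
    have := hca _ _ f₁ e₁
    have := hca _ _ f₁ e₂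
    have := hca _ _ f₁ e₃
    have := hca _ _ f₂ e₁
    have := hca _ _ f₂ e₂
    have := hca _ _ f₂ e₃
    have := hca _ _ f₃ e₁
    have := hca _ _ f₃ e₂
    have := hca _ _ f₃ e₃
    have := hne _ _ _ hc₁.symm h₁₂
    have := hne _ _ _ hc₁.symm h₁₃
    have := hne _ _ _ hc₂.symm h₂₁
    have := hne _ _ _ h₁ h₁₂
    have := hne _ _ _ h₁ h₁₃
    have := hne _ _ _ h₂ h₂₃
    have := hne _ _ _ h₁.symm (fun h => h₂₁ h.symm)
    have := hne _ _ _ h₁.symm (fun h => h₃₁ h.symm)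
    have := hne _ _ _ h₂.symm (fun h => h₃₂ h.symm)
    intro i j hij
    fin_cases i <;> fin_cases j <;>
      first
      | rfl
      | exact absurd hij (by assumption)
      | exact absurd hij.symm (by assumption)
  have := nadj _ _ f₁.symm
  have := nadj _ _ f₂.symm
  have := nadj _ _ f₃.symm
  have := nadj _ _ (e₁.trans e₂.symm)
  have := nadj _ _ (e₁.trans e₃.symm)
  have := nadj _ _ (e₂.trans e₃.symm)
  have := nadj _ _ (f₁.trans f₂.symm)
  have := nadj _ _ (f₁.trans f₃.symm)
  have := nadj _ _ (f₂.trans f₃.symm)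
  refine ⟨⟨⟨![c, a₁, a₂, a₃, b₁, b₂, b₃], inj⟩, ?_⟩⟩
  intro i j
  fin_cases i <;> fin_cases j <;>
    first
    | exact iff_of_true (by assumption) (by simp [bipartiteClaw])
    | exact iff_of_true (X.adj_symm (by assumption)) (by simp [bipartiteClaw])
    | exact iff_of_false X.irrefl (by simp [bipartiteClaw])
    | exact iff_of_false (by assumption) (by simp [bipartiteClaw])
    | exact iff_of_false (mt X.adj_symm (by assumption)) (by simp [bipartiteClaw])

/-! ### Long induced cycles and the graph between two fibers -/

/-- In a chordal bipartite graph there is no infinite walk whose vertices at distance three along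
the walk are never adjacent. -/
theorem IsChordalBipartite.exists_adj_add_three [Finite Ω] (hX : X.IsChordalBipartite) (z : ℕ → Ω)
    (hz : ∀ k, X.Adj (z k) (z (k + 1))) : ∃ k, X.Adj (z k) (z (k + 3)) := by
  classical
  by_contra! h3
  obtain ⟨col⟩ := hX.1.nonempty_coloring
  have hcol : ∀ i g, col (z i) = col (z (i + g)) ↔ Even g := by
    intro i g
    induction g with
    | zero => simp
    | succ g ih =>
      have := col.valid (hz (i + g))
      rw [Nat.even_add_one, ← ih, ← add_assoc]
      cases h1 : col (z i) <;> cases h2 : col (z (i + g)) <;>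
        cases h4 : col (z (i + g + 1)) <;> simp_all
  -- By finiteness some `z i = z j` with `i < j`, so `z i` is adjacent to `z (j - 1)`. The span is
  -- odd, and span 1 would make `z i = z (i + 2)` adjacent to `z (i + 3)`.
  have hex : ∃ g, 2 ≤ g ∧ ∃ i, X.Adj (z i) (z (i + g)) := by
    obtain ⟨i, j, hne, hij⟩ := Finite.exists_ne_map_eq_of_infinite z
    have main : ∀ i j, i < j → z i = z j → ∃ g, 2 ≤ g ∧ ∃ i, X.Adj (z i) (z (i + g)) := by
      intro i j hlt hij
      obtain ⟨g, rfl⟩ := Nat.exists_eq_add_of_lt hlt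
      have hev : Even (g + 1) := (hcol i (g + 1)).1 (by rw [hij, add_assoc])
      have hadj : X.Adj (z i) (z (i + g)) := by
        rw [hij]
        exact (hz (i + g)).symm
      rcases Nat.lt_or_ge g 2 with hg | hg
      · interval_cases g
        · simp at hev
        · refine absurd (hz (i + 2)) ?_
          rw [show i + 2 = i + 1 + 1 from rfl, ← hij]
          exact h3 i
      · exact ⟨g, hg, i, hadj⟩
    rcases lt_or_gt_of_ne hne with h | h
    · exact main i j h hij
    · exact main j i h hij.symm
  -- The minimum is over all starting points, so the chord closes a stretch of the walk into a cycle
  -- on `g + 1` vertices without shorter chords. As `g` is odd and not 3, `g + 1 ≥ 6`.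
  set g := Nat.find hex with hg
  obtain ⟨hg2, i, hi⟩ := Nat.find_spec hex
  rw [← hg] at hg2 hi
  have hodd : ¬ Even g := fun h => col.valid hi ((hcol i g).2 h)
  have hg3 : g ≠ 3 := by
    intro h
    exact h3 i (h ▸ hi)
  have hg5 : 6 ≤ g + 1 := by
    rcases Nat.lt_or_ge g 5 with h | h
    · exfalso
      interval_cases g <;> first | omega | (exact hodd (by decide))
    · omega
  have hmin : ∀ j m, 2 ≤ m → X.Adj (z j) (z (j + m)) → g ≤ m := fun j m hm hj =>
    Nat.find_min' hex ⟨hm, j, hj⟩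
  have hadj : ∀ a b, a < b → b ≤ g →
      (X.Adj (z (i + a)) (z (i + b)) ↔ b - a = 1 ∨ b - a = g) := by
    intro a b hab hb
    obtain ⟨d, rfl⟩ := Nat.exists_eq_add_of_lt hab
    constructor
    · intro h
      rcases Nat.eq_zero_or_pos d with rfl | hd
      · left; omega
      · right
        have := hmin (i + a) (d + 1) (by omega)
          (by rwa [show i + a + (d + 1) = i + (a + d + 1) by omega])
        omega
    · rintro (h | h)
      · obtain rfl : d = 0 := by omega
        exact hz (i + a)
      · obtain rfl : a = 0 := by omega
        rwa [show 0 + d + 1 = g by omega]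
  -- A repetition inside the stretch would again produce a chord, of span below `g`.
  have hinj : ∀ a b, a < b → b ≤ g → z (i + a) ≠ z (i + b) := by
    intro a b hab hb he
    obtain ⟨d, rfl⟩ := Nat.exists_eq_add_of_lt hab
    have h1 : X.Adj (z (i + a)) (z (i + a + d)) := by
      rw [he, show i + (a + d + 1) = i + a + d + 1 by omega]
      exact (hz (i + a + d)).symm
    rcases Nat.lt_or_ge d 2 with hd | hd
    · interval_cases d
      · exact X.irrefl h1
      · refine h3 (i + a) ?_
        rw [he]
        exact hz (i + a + 2)
    · have := hmin _ _ hd h1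
      omega
  refine hX.2 (g + 1) hg5 ⟨⟨⟨fun k => z (i + k), ?_⟩, ?_⟩⟩
  · intro a b hab
    rcases lt_trichotomy a b with h | h | h
    · exact absurd hab (hinj a b h (by omega))
    · exact h
    · exact absurd hab.symm (hinj b a h (by omega))
  · have hlt : ∀ a b : Fin (g + 1), a < b →
        (X.Adj (z (i + a)) (z (i + b)) ↔ (cycleGraph (g + 1)).Adj a b) := by
      intro a b h
      rw [hadj a b h (by omega), cycleGraph_adj', Fin.sub_val_of_le h.le, Fin.coe_sub_iff_lt.2 h]
      have : a.val < b.val := h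
      omega
    intro a b
    rcases lt_trichotomy a b with h | h | h
    · exact hlt a b h
    · subst h
      simp
    · have := hlt b a h
      rw [X.adj_comm, (cycleGraph (g + 1)).adj_comm] at this
      exact this

/-- The bipartite graph between two fibers of `𝒳` is a disjoint union of complete bipartite
graphs. -/
theorem IsChordalBipartite.adj_of_path [Finite Ω] (hX : X.IsChordalBipartite)
    {𝒳 : CoherentConfiguration Ω} (hD : 𝒳.IsRelation X.arcSet) {a b c d : Ω}
    (hab : X.Adj a b) (hbc : X.Adj b c) (hcd : X.Adj c d)
    (hac : 𝒳.fiberSetoid a c) (hbd : 𝒳.fiberSetoid b d) : X.Adj a d := by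
  by_contra had
  -- `P` describes a bad path. Since `b` sees `a` and `d` does not, `d` has a neighbor `e` in the
  -- fiber of `a` not seen by `b`; thus `b c d e` is bad too, and iteration gives the walk.
  let P : Ω × Ω × Ω × Ω → Prop := fun q => X.Adj q.1 q.2.1 ∧ X.Adj q.2.1 q.2.2.1 ∧
    X.Adj q.2.2.1 q.2.2.2 ∧ ¬ X.Adj q.1 q.2.2.2 ∧ 𝒳.fiberSetoid q.1 q.2.2.1 ∧
    𝒳.fiberSetoid q.2.1 q.2.2.2
  have step : ∀ q : {q // P q}, ∃ r : {q // P q}, r.1.1 = q.1.2.1 ∧ r.1.2.1 = q.1.2.2.1 ∧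
      r.1.2.2.1 = q.1.2.2.2 := by
    rintro ⟨⟨a, b, c, d⟩, hab, hbc, hcd, had, hac, hbd⟩
    obtain ⟨e, hde, hbe, hea⟩ := exists_mem_not_mem hD hbd (a := a) hab.symm
      (fun h => had h.symm)
    exact ⟨⟨(b, c, d, e), hbc, hcd, hde, hbe, hbd,
      𝒳.fiberSetoid.symm (𝒳.fiberSetoid.trans hea hac)⟩, rfl, rfl, rfl⟩
  choose f hf1 hf2 hf3 using step
  let s : ℕ → {q // P q} := fun n => f^[n] ⟨(a, b, c, d), hab, hbc, hcd, had, hac, hbd⟩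
  have hs : ∀ n, s (n + 1) = f (s n) := fun n => Function.iterate_succ_apply' _ _ _
  have h1 : ∀ n, (s (n + 1)).1.1 = (s n).1.2.1 := fun n => by rw [hs, hf1]
  have h2 : ∀ n, (s (n + 2)).1.1 = (s n).1.2.2.1 := fun n => by rw [h1, hs, hf2]
  have h3 : ∀ n, (s (n + 3)).1.1 = (s n).1.2.2.2 := fun n => by rw [h2, hs, hf3]
  obtain ⟨k, hk⟩ := hX.exists_adj_add_three (fun n => (s n).1.1) fun k => by
    rw [h1]
    exact (s k).2.1
  rw [h3] at hk
  exact (s k).2.2.2.2.1 hk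

/-! ### Excluding three-edge induced matchings -/

/-- There is no induced matching with three edges between two fibers. -/
theorem not_induced_matching [Finite Ω] {α : Ω} (hconn : X.Connected)
    (hX : X.IsChordalBipartite) (hfree : ¬ bipartiteClaw.IsIndContained X)
    {𝒳 : CoherentConfiguration Ω} (hWL : X.WL α ≤ 𝒳) (n : ℕ) :
    ∀ u w : Fin 3 → Ω, (∀ j, X.dist α (u j) = n) → (∀ j, X.dist α (w j) = n + 1) →
      (∀ j, 𝒳.fiberSetoid (u 0) (u j)) → (∀ j k, X.Adj (u j) (w k) ↔ j = k) → False := by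
  have hD := isRelation_arcSet hWL
  have hdist : ∀ {x y}, X.Adj x y → X.dist α y = X.dist α x + 1 ∨
      X.dist α y + 1 = X.dist α x := fun {x y} h => by
    have h1 := h.diff_dist_adj (u := α)
    have h2 := dist_ne_of_adj hconn hX.1 (α := α) h
    omega
  induction n with
  | zero =>
    intro u w hu _ _ huw
    have h0 : α = u 0 := hconn.dist_eq_zero_iff.1 (hu 0)
    have h1 : α = u 1 := hconn.dist_eq_zero_iff.1 (hu 1)
    have := (huw 0 1).1 (by rw [← h0, h1]; exact (huw 1 1).2 rfl)
    simp at this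
  | succ n ih =>
    intro u w hu hw hfib huw
    obtain ⟨p₀, hup₀, hp₀⟩ := hconn.exists_adj_dist_eq (hu 0)
    have hp : ∀ j, ∃ p, X.Adj (u j) p ∧ 𝒳.fiberSetoid p p₀ := fun j =>
      exists_of_fiberSetoid hD (hfib j) hup₀
    choose p hup hpp₀ using hp
    have hpn : ∀ j, X.dist α (p j) = n := fun j => by
      rw [dist_eq_of_fiberSetoid hconn hWL (hpp₀ j), hp₀]
    have hpp : ∀ j k, 𝒳.fiberSetoid (p j) (p k) := fun j k =>
      𝒳.fiberSetoid.trans (hpp₀ j) (𝒳.fiberSetoid.symm (hpp₀ k))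
    have huu : ∀ j k, 𝒳.fiberSetoid (u j) (u k) := fun j k =>
      𝒳.fiberSetoid.trans (𝒳.fiberSetoid.symm (hfib j)) (hfib k)
    by_cases hmatch : ∀ j k, X.Adj (p j) (u k) → j = k
    · refine ih p u hpn hu (hpp 0) fun j k => ⟨hmatch j k, ?_⟩
      rintro rfl
      exact (hup j).symm
    push Not at hmatch
    obtain ⟨j, k, hjk, hne⟩ := hmatch
    obtain ⟨l, hlj, hlk⟩ : ∃ l : Fin 3, l ≠ j ∧ l ≠ k := by
      clear hjk
      revert j k
      decide
    have hadj : ∀ j, X.Adj (u j) (w j) := fun j => (huw j j).2 rfl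
    have hnadj : ∀ {j k}, j ≠ k → ¬ X.Adj (u j) (w k) := fun h h' => h ((huw _ _).1 h')
    -- Otherwise `p j` is the center of a claw whose legs are the three matching edges.
    have hpl : ¬ X.Adj (p j) (u l) := fun h =>
      hfree (bipartiteClaw_isIndContained hX.1 (hup j).symm hjk h (hadj j) (hadj k) (hadj l)
        (hnadj hne) (hnadj hlj.symm) (hnadj hne.symm) (hnadj hlk.symm) (hnadj hlj) (hnadj hlk))
    have far : ∀ {x y}, X.dist α x + 1 < X.dist α y → ¬ X.Adj x y := fun h h' => by
      have := hdist h'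
      omega
    match n, hpn, hu, hw with
    | 0, hpn, hu, hw =>
      have h0 : ∀ i, α = p i := fun i => hconn.dist_eq_zero_iff.1 (hpn i)
      exact hpl (by rw [← h0 j, h0 l]; exact (hup l).symm)
    | 1, hpn, hu, hw =>
      -- There is no room for two steps toward `α`, so the third leg goes from `α` back out to `p
      -- l`; by `adj_of_path`, `p l` misses `u j` and `u k`.
      have hα : ∀ i, X.Adj (p i) α := fun i => (dist_eq_one_iff_adj.1 (hpn i)).symm
      have hpl' : ∀ i, X.Adj (p j) (u i) → ¬ X.Adj (u i) (p l) := fun i hi hil =>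
        hpl (hX.adj_of_path hD hi hil (hup l).symm (hpp _ _) (huu _ _))
      have hαw : ∀ i, ¬ X.Adj α (w i) := fun i => far (by simp [hw])
      exact hfree (bipartiteClaw_isIndContained hX.1 (hup j).symm hjk (hα j) (hadj j) (hadj k)
        (hα l).symm (hnadj hne) (hpl' j (hup j).symm) (hnadj hne.symm) (hpl' k hjk)
        (hαw j) (hαw k))
    | m + 2, hpn, hu, hw =>
      -- The third leg `q`, `r` descends toward `α`; distances alone rule out unwanted adjacencies.
      obtain ⟨q, hpq, hq⟩ := hconn.exists_adj_dist_eq (hpn j)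
      obtain ⟨r, hqr, hr⟩ := hconn.exists_adj_dist_eq hq
      have hru : ∀ i, ¬ X.Adj (u i) r := fun i h => far (by rw [hr, hu]; omega) h.symm
      have hqw : ∀ i, ¬ X.Adj q (w i) := fun i => far (by rw [hq, hw]; omega)
      exact hfree (bipartiteClaw_isIndContained hX.1 (hup j).symm hjk hpq (hadj j) (hadj k)
        hqr (hnadj hne) (hru j) (hnadj hne.symm) (hru k) (hqw j) (hqw k))

end SimpleGraph

/-! ### From three twin classes to an induced matching -/

theorem theorem5p1 {Ω : Type*} [Finite Ω] (X : SimpleGraph Ω) (α : Ω)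
    (hconn : X.Connected) (hchordal : X.IsChordalBipartite)
    (hfree : ¬ SimpleGraph.bipartiteClaw.IsIndContained X)
    (𝒳 : CoherentConfiguration Ω) (hWL : X.WL α ≤ 𝒳)
    (Δ Γ : Set Ω) (hΔ : 𝒳.IsFiber Δ) (hΓ : 𝒳.IsFiber Γ) :
    Nat.card (Quotient (X.twinsBetween Δ Γ)) ≤ 2 := by
  classical
  have hD := SimpleGraph.isRelation_arcSet hWL
  have hdist : ∀ {x y}, 𝒳.fiberSetoid x y → X.dist α x = X.dist α y :=
    SimpleGraph.dist_eq_of_fiberSetoid hconn hWL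
  have hΔΔ : ∀ {x y}, x ∈ Δ → y ∈ Δ → ¬ X.Adj x y := fun hx hy h =>
    SimpleGraph.dist_ne_of_adj hconn hchordal.1 h (hdist (hΔ.fiberSetoid hx hy))
  have twins : ∀ x y : Δ, (∀ c ∈ Γ, X.Adj c x ↔ X.Adj c y) →
      (X.twinsBetween Δ Γ) x y := by
    rintro ⟨x, hx⟩ ⟨y, hy⟩ h ⟨c, hc⟩ - -
    constructor
    · rintro ⟨hadj, ⟨hcΔ, -⟩ | ⟨hcΓ, -⟩⟩
      · exact absurd hadj (hΔΔ hcΔ hx)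
      · exact ⟨(h c hcΓ).1 hadj, Or.inr ⟨hcΓ, hy⟩⟩
    · rintro ⟨hadj, ⟨hcΔ, -⟩ | ⟨hcΓ, -⟩⟩
      · exact absurd hadj (hΔΔ hcΔ hy)
      · exact ⟨(h c hcΓ).2 hadj, Or.inr ⟨hcΓ, hx⟩⟩
  by_contra! hcard
  have := Fintype.ofFinite (Quotient (X.twinsBetween Δ Γ))
  rw [Nat.card_eq_fintype_card] at hcard
  obtain ⟨A, B, C, hAB, hAC, hBC⟩ := Fintype.two_lt_card_iff.1 hcard
  let Q : Fin 3 → Quotient (X.twinsBetween Δ Γ) := ![A, B, C]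
  have hQ : Function.Injective Q := by
    intro i j
    fin_cases i <;> fin_cases j <;> simp [Q, hAB, hAC, hBC, hAB.symm, hAC.symm, hBC.symm]
  let u : Fin 3 → Δ := fun i => (Q i).out
  have hu : ∀ i j, (X.twinsBetween Δ Γ) (u i) (u j) → i = j := by
    intro i j h
    have := Quotient.sound (s := X.twinsBetween Δ Γ) h
    simp only [u, Quotient.out_eq] at this
    exact hQ this
  have huu : ∀ i j, 𝒳.fiberSetoid (u i) (u j) := fun i j => hΔ.fiberSetoid (u i).2 (u j).2
  obtain ⟨i, c, hc, hic⟩ : ∃ i, ∃ c ∈ Γ, X.Adj (u i) c := by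
    by_contra! h
    have := hu 0 1 (twins _ _ fun c hc => by
      simp [X.adj_comm c, h _ c hc])
    simp at this
  have hw : ∀ j, ∃ w, X.Adj (u j) w ∧ w ∈ Γ := fun j => by
    obtain ⟨w, h1, h2⟩ := CoherentConfiguration.exists_of_fiberSetoid hD (huu i j) hic
    exact ⟨w, h1, hΓ.mem_of_fiberSetoid h2 hc⟩
  choose w hadj hwΓ using hw
  have hww : ∀ i j, 𝒳.fiberSetoid (w i) (w j) := fun i j => hΓ.fiberSetoid (hwΓ i) (hwΓ j)
  have huw : ∀ j k, X.Adj (u j) (w k) ↔ j = k := by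
    intro j k
    -- If `u j` sees `w k`, it lies in the same complete bipartite component as `u k`, so the two
    -- are twins.
    refine ⟨fun h => hu j k (twins _ _ fun c hc => ⟨fun h' => ?_, fun h' => ?_⟩), ?_⟩
    · exact hchordal.adj_of_path hD h' h (hadj k).symm (hΓ.fiberSetoid hc (hwΓ k)) (huu j k)
    · exact hchordal.adj_of_path hD h' (hadj k) h.symm (hΓ.fiberSetoid hc (hwΓ k)) (huu k j)
    · rintro rfl
      exact hadj j
  have h1 := (hadj 0).diff_dist_adj (u := α)
  have h2 := SimpleGraph.dist_ne_of_adj hconn hchordal.1 (α := α) (hadj 0)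
  -- Either side of the matching may be the one nearer to `α`; the roles of `u` and `w` are swapped
  -- accordingly.
  rcases h1 with h1 | h1 | h1
  · exact h2 h1.symm
  · refine SimpleGraph.not_induced_matching hconn hchordal hfree hWL _ (fun i => u i) w
      (fun j => (hdist (huu 0 j)).symm) (fun j => ?_) (huu 0) huw
    rw [← hdist (hww 0 j), h1]
  · refine SimpleGraph.not_induced_matching hconn hchordal hfree hWL _ w (fun i => u i)
      (fun j => (hdist (hww 0 j)).symm) (fun j => ?_) (hww 0) fun j k => ?_
    · rw [← hdist (huu 0 j)]
      omega
    · rw [X.adj_comm, huw, eq_comm]
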